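/- Let $k\ge 0$ be an integer, and write $\mathcal P[n]$ for the power set of $[n]=\{1,\dots,n\}$. There is a constant $C_k>0$, depending only on $k$, such that for every integer $n\ge 1$, every family $\mathcal A\subset\mathcal P[n]$ with $|A\setminus B|\neq k$ for all $A,B\in\mathcal A$ (not necessarily distinct) satisfies $$|\mathcal A|\le \frac{C_k}{n^k}\binom{n}{\lfloor n/2\rfloor}.$$ If $k\ge 1$, this is tight up to the constant: there is a constant $c_k>0$, depending only on $k$, such that for every $n\ge 1$ there is a family $\mathcal A\subset\mathcal P[n]$ with $|A\setminus B|\neq k$ for all $A,B\in\mathcal A$ and $$|\mathcal A|\ge \frac{c_k}{n^k}\binom{n}{\lfloor n/2\rfloor};$$ moreover, when $n$ is prime, there is such a family with $|\mathcal A|\ge \frac{1}{n^k}\binom{n}{\lfloor n/2\rfloor}$. -/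

import Mathlib

/-!
**Upper bound.** A random copy of a simple structure in `Fin n` is tested against the family `𝒜`. The
structure consists of the sets `initSeg n i ∪ T f`, where the initial segments form a chain and `T f`
runs over the transversals of a disjoint `m × N` grid, indexed by tuples `f : Fin m → Fin N`; here `m`
depends only on `k`, and `N` is of order `n`. If two of these sets lie in `𝒜`, the one with
the smaller chain index minus the other is the difference of their transversals, so the tuples
occurring, at whatever level of the chain, have no two at Hamming distance `k`.

Such a family of tuples has size `O(N ^ (m - k))` (`card_le_of_forall_card_diffSet_ne`). This is a
case of the Frankl–Füredi theorem, proved by a simplified delta-system method. A member `f` is rich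
in a direction `E` if it can be changed in all coordinates of `E`, and only there, while avoiding any
prescribed values. Deleting fibres that are not rich (`exists_rich_or_poor`) either leaves a
nonempty part, for which the difference sets are closed under union (`union_mem_types`), or reduces the
number of difference sets at the cost of a constant factor (`exists_subset_notMem_types`). In the first
case, as no difference set has size `k` and `m` is large, a pigeonhole argument
(`exists_card_eq_forall_not_subset`) gives `k` coordinates containing no difference set, and the
remaining `m - k` coordinates determine the tuple.

One tuple may occur at several levels, which is controlled by a second use of the same bound: given
that a random `I` lies in `𝒜`, a larger random `J ⊇ I` with `m ≤ |J \ I|` does so with probability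
`O(N⁻ᵏ)` (`hits_le`). After restricting the sizes in `𝒜` to a residue class modulo a large constant
`M`, there are at most `n / M` relevant levels, so the expected number of comparable pairs is at most
half the expected number of members, and the inequality `|Z| - #{pairs in Z} ≤ 1` yields the bound for
sizes between `n / 4` and `3 * n / 4` (`pow_mul_card_le`). The other sizes are exponentially rare.

**Lower bound.** Two sets of size `w` whose polynomials `∏ (X - a)` over a field agree in the `k`
coefficients below the leading one do not differ in exactly `k` elements
(`card_sdiff_ne_of_coeff_eq`). Over `ZMod p` with `n ≤ p`, this partitions the middle layer into
`pᵏ` admissible classes; one takes `p = n` if `n` is prime, and `p ≤ 2 * n` by Bertrand's postulate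
otherwise.
-/

namespace SetDifference

open Finset

/-! ### Tuples with a forbidden Hamming distance -/

section Tuples

variable {ι α : Type*} [Fintype ι] [DecidableEq α]

/-- The set of coordinates in which two tuples differ; its size is their Hamming distance. -/
def diffSet (f g : ι → α) : Finset ι := {i | f i ≠ g i}

lemma mem_diffSet {f g : ι → α} {i : ι} : i ∈ diffSet f g ↔ f i ≠ g i := by
  simp [diffSet]

variable [DecidableEq ι]

/-- The types of a family of tuples: the nonempty difference sets of its pairs. -/
def types (F : Finset (ι → α)) : Finset (Finset ι) :=
  {E | E.Nonempty ∧ ∃ f ∈ F, ∃ g ∈ F, diffSet f g = E}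

lemma mem_types {F : Finset (ι → α)} {E : Finset ι} :
    E ∈ types F ↔ E.Nonempty ∧ ∃ f ∈ F, ∃ g ∈ F, diffSet f g = E := by
  simp [types]

lemma types_mono {F G : Finset (ι → α)} (h : F ⊆ G) : types F ⊆ types G := by
  intro E hE
  obtain ⟨h1, f, hf, g, hg, h2⟩ := mem_types.1 hE
  exact mem_types.2 ⟨h1, f, h hf, g, h hg, h2⟩

/-- `f` is rich in `F` in the direction `E` if, for every prescribed forbidden tuple `s`, the
family `F` has a member agreeing with `f` off `E` and avoiding `s` everywhere on `E`. This plays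
the role of `f` restricted to `Eᶜ` being the kernel of a large sunflower in `F`. -/
def Rich (F : Finset (ι → α)) (E : Finset ι) (f : ι → α) : Prop :=
  ∀ s : ι → α, ∃ g ∈ F, (∀ i ∉ E, g i = f i) ∧ ∀ i ∈ E, g i ≠ s i

/-- If every member of a nonempty subfamily `H` of `F` is rich in `H` in the directions of all
types of `F`, one can move along two types in succession, so the types are closed under union. -/
lemma union_mem_types {F H : Finset (ι → α)} (hH : H.Nonempty) (hHF : H ⊆ F)
    (hr : ∀ E ∈ types F, ∀ f ∈ H, Rich H E f) {D E : Finset ι} (hD : D ∈ types F)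
    (hE : E ∈ types F) : D ∪ E ∈ types F := by
  obtain ⟨f, hf⟩ := hH
  obtain ⟨g, hg, hg1, hg2⟩ := hr D hD f hf f
  obtain ⟨h, hh, hh1, hh2⟩ := hr E hE g hg f
  refine mem_types.2 ⟨(mem_types.1 hD).1.mono subset_union_left, h, hHF hh, f, hHF hf, ?_⟩
  ext i
  rw [mem_diffSet, mem_union]
  by_cases hi : i ∈ E
  · simp [hi, hh2 i hi]
  · rw [hh1 i hi]
    by_cases hi' : i ∈ D
    · simp [hi', hg2 i hi']
    · simp [hi, hi', hg1 i hi']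

/-- A union-closed family of nonempty sets on sufficiently many points, none of which has size
`k`, leaves some `k`-set without a member inside it. -/
lemma exists_card_eq_forall_not_subset {k : ℕ} (T : Finset (Finset ι))
    (hne : ∀ E ∈ T, E.Nonempty) (hun : ∀ D ∈ T, ∀ E ∈ T, D ∪ E ∈ T) (hk : ∀ E ∈ T, #E ≠ k)
    (hm : k + k * 2 ^ k ≤ Fintype.card ι) : ∃ W : Finset ι, #W = k ∧ ∀ E ∈ T, ¬ E ⊆ W := by
  by_contra! hcon
  obtain ⟨I, hI, hmax⟩ := exists_max_image
    (univ.filter fun I : Finset ι => ∀ E ∈ T, ¬ E ⊆ I) card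
    ⟨∅, by
      simp only [mem_filter, mem_univ, true_and]
      intro E hE h
      exact (hne E hE).ne_empty (subset_empty.1 h)⟩
  simp only [mem_filter, mem_univ, true_and] at hI hmax
  have hIk : #I < k := by
    by_contra! h
    obtain ⟨W, hW, hWk⟩ := exists_subset_card_eq h
    obtain ⟨E, hE, hEW⟩ := hcon W hWk
    exact hI E hE (hEW.trans hW)
  have hv : ∀ v ∈ Iᶜ, ∃ E ∈ T, v ∈ E ∧ E ⊆ insert v I := by
    intro v hv
    by_contra! h
    have := hmax (insert v I) (by
      intro E hE hsub
      by_cases hvE : v ∈ E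
      · exact h E hE hvE hsub
      · exact hI E hE ((subset_insert_iff_of_notMem hvE).1 hsub))
    rw [card_insert_of_notMem (mem_compl.1 hv)] at this
    omega
  choose! e heT hev heI using hv
  -- Many points outside `I` have edges with the same trace on `I`.
  obtain ⟨D, hD, hfib⟩ := exists_le_card_fiber_of_mul_le_card_of_maps_to
    (s := Iᶜ) (t := I.powerset) (f := fun v => e v ∩ I) (n := k)
    (fun v _ => mem_powerset.2 inter_subset_right) ⟨∅, empty_mem_powerset I⟩ (by
      rw [card_powerset, card_compl, mul_comm]
      have : 2 ^ #I ≤ 2 ^ k := Nat.pow_le_pow_right (by norm_num) hIk.le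
      have := Nat.mul_le_mul_left k this
      omega)
  have hDI := mem_powerset.1 hD
  have hDk : #D < k := (card_le_card hDI).trans_lt hIk
  obtain ⟨J, hJ, hJk⟩ := exists_subset_card_eq ((Nat.sub_le k #D).trans hfib)
  have hJne : J.Nonempty := card_pos.1 (by omega)
  have hJ' : ∀ v ∈ J, v ∈ Iᶜ ∧ e v ∩ I = D := fun v hv => by simpa using hJ hv
  have hmem : ∀ J' : Finset ι, J'.Nonempty → J' ⊆ J → J'.biUnion e ∈ T := by
    intro J' hJ'ne
    induction hJ'ne using Finset.Nonempty.cons_induction with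
    | singleton a =>
      intro h
      simpa using heT a (hJ' a (h (mem_singleton_self a))).1
    | cons a s ha hs ih =>
      intro h
      rw [cons_eq_insert] at h ⊢
      rw [biUnion_insert]
      exact hun _ (heT a (hJ' a (h (mem_insert_self _ _))).1) _
        (ih ((subset_insert _ _).trans h))
  refine hk _ (hmem J hJne Subset.rfl) ?_
  have hU : J.biUnion e = J ∪ D := by
    ext x
    simp only [mem_biUnion, mem_union]
    constructor
    · rintro ⟨v, hv, hx⟩
      rcases mem_insert.1 (heI v (hJ' v hv).1 hx) with rfl | hxI
      · exact Or.inl hv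
      · exact Or.inr ((hJ' v hv).2 ▸ mem_inter.2 ⟨hx, hxI⟩)
    · rintro (hx | hx)
      · exact ⟨x, hx, hev x (hJ' x hx).1⟩
      · obtain ⟨v, hv⟩ := hJne
        rw [← (hJ' v hv).2] at hx
        exact ⟨v, hv, (mem_inter.1 hx).1⟩
  rw [hU, card_union_of_disjoint, hJk]
  · omega
  · rw [disjoint_left]
    intro x hx hxD
    exact mem_compl.1 (hJ' x hx).1 (hDI hxD)

/-- Successive deletion of non-rich fibres: a family splits into a part in which everything is
rich, and parts `G E` in which nothing is rich in the direction `E`. -/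
lemma exists_rich_or_poor (T : Finset (Finset ι)) (F : Finset (ι → α)) :
    ∃ H ⊆ F, (∀ E ∈ T, ∀ f ∈ H, Rich H E f) ∧ ∃ G : Finset ι → Finset (ι → α),
      F ⊆ H ∪ T.biUnion G ∧ ∀ E ∈ T, G E ⊆ F ∧ ∀ f, ¬ Rich (G E) E f := by
  induction F using Finset.strongInduction with
  | H F ih =>
  by_cases hst : ∀ E ∈ T, ∀ f ∈ F, Rich F E f
  · refine ⟨F, Subset.rfl, hst, fun _ => ∅, subset_union_left, fun E _ => ⟨empty_subset _, ?_⟩⟩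
    intro f h
    obtain ⟨g, hg, _⟩ := h f
    simp at hg
  · push Not at hst
    obtain ⟨E₀, hE₀, f₀, hf₀, hpoor⟩ := hst
    set C := F.filter fun g => ∀ i ∉ E₀, g i = f₀ i with hC
    have hCF : C ⊆ F := filter_subset _ _
    have hmemC : ∀ g, g ∈ C ↔ g ∈ F ∧ ∀ i ∉ E₀, g i = f₀ i := fun g => by simp [hC]
    obtain ⟨H, hH, hHr, G, hG, hG'⟩ := ih (F \ C)
      (sdiff_ssubset hCF ⟨f₀, (hmemC _).2 ⟨hf₀, fun _ _ => rfl⟩⟩)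
    refine ⟨H, hH.trans sdiff_subset, hHr,
      fun E => if E = E₀ then G E ∪ C else G E, ?_, ?_⟩
    · intro f hf
      by_cases hfC : f ∈ C
      · exact mem_union_right _ (mem_biUnion.2 ⟨E₀, hE₀, by simp [hfC]⟩)
      · rcases mem_union.1 (hG (mem_sdiff.2 ⟨hf, hfC⟩)) with h | h
        · exact mem_union_left _ h
        · obtain ⟨E, hE, hfE⟩ := mem_biUnion.1 h
          refine mem_union_right _ (mem_biUnion.2 ⟨E, hE, ?_⟩)
          split_ifs
          · exact mem_union_left _ hfE
          · exact hfE
    · intro E hE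
      obtain ⟨h1, h2⟩ := hG' E hE
      dsimp only
      split_ifs with hEE
      · subst hEE
        refine ⟨union_subset (h1.trans sdiff_subset) hCF, fun f hr => ?_⟩
        by_cases hff : ∀ i ∉ E, f i = f₀ i
        · apply hpoor
          intro s
          obtain ⟨g, hg, hg1, hg2⟩ := hr s
          refine ⟨g, ?_, fun i hi => (hg1 i hi).trans (hff i hi), hg2⟩
          rcases mem_union.1 hg with h | h
          · exact sdiff_subset (h1 h)
          · exact hCF h
        · apply h2 f
          intro s
          obtain ⟨g, hg, hg1, hg2⟩ := hr s
          refine ⟨g, ?_, hg1, hg2⟩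
          rcases mem_union.1 hg with h | h
          · exact h
          · exact absurd (fun i hi => (hg1 i hi).symm.trans (((hmemC g).1 h).2 i hi)) hff
      · exact ⟨h1.trans sdiff_subset, h2⟩

/-- A family without rich members in the direction `E` has a subfamily, of proportion at least
`1 / |ι|`, without the type `E`. -/
lemma exists_subset_notMem_types {G : Finset (ι → α)} {E : Finset ι}
    (hG : ∀ f, ¬ Rich G E f) :
    ∃ G' ⊆ G, #G ≤ Fintype.card ι * #G' ∧ E ∉ types G' := by
  rcases G.eq_empty_or_nonempty with rfl | ⟨f₀, hf₀⟩
  · exact ⟨∅, Subset.rfl, by simp, by simp [mem_types]⟩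
  have hs : ∀ f : ι → α, ∃ s : ι → α, ∀ g ∈ G, (∀ i ∉ E, g i = f i) → ∃ i ∈ E, g i = s i := by
    intro f
    have := hG f
    unfold Rich at this
    push Not at this
    exact this
  choose s hs using hs
  -- `E.piecewise f₀ g` represents the fibre of `g` over the coordinates outside `E`.
  have hidx : ∀ g ∈ G, ∃ i ∈ E, g i = s (E.piecewise f₀ g) i := fun g hg =>
    hs _ g hg fun i hi => by simp [hi]
  have : Nonempty ι := ⟨(hidx f₀ hf₀).choose⟩
  choose! idx hidxE hidx using hidx
  obtain ⟨i, -, hi⟩ := exists_max_image (univ : Finset ι) (fun i => #{g ∈ G | idx g = i})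
    univ_nonempty
  refine ⟨{g ∈ G | idx g = i}, filter_subset _ _, ?_, ?_⟩
  · rw [card_eq_sum_card_fiberwise (f := idx) (s := G) (t := univ) (by simp), ← card_univ]
    exact sum_le_card_nsmul _ _ _ fun j _ => hi j (mem_univ j)
  · intro hE
    obtain ⟨-, g, hg, h, hh, hgh⟩ := mem_types.1 hE
    simp only [mem_filter] at hg hh
    have hpw : E.piecewise f₀ g = E.piecewise f₀ h := by
      ext j
      by_cases hj : j ∈ E
      · simp [hj]
      · have : g j = h j := by
          by_contra hne
          exact hj (hgh ▸ mem_diffSet.2 hne)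
        simp [hj, this]
    have h1 := hidx g hg.1
    have h2 := hidx h hh.1
    rw [hg.2, hpw] at h1
    rw [hh.2] at h2
    have hiE : i ∈ E := hg.2 ▸ hidxE g hg.1
    rw [← hgh, mem_diffSet] at hiE
    exact hiE (h1.trans h2.symm)

variable [Fintype α]

/-- If no type of `F` lies inside `W`, tuples in `F` are determined by their values off `W`. -/
lemma card_le_pow_of_forall_types_not_subset {F : Finset (ι → α)} {W : Finset ι}
    (hW : ∀ E ∈ types F, ¬ E ⊆ W) :
    #F ≤ Fintype.card α ^ (Fintype.card ι - #W) := by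
  have hinj : Set.InjOn (fun (f : ι → α) (i : {i // i ∈ Wᶜ}) => f i) F := by
    intro f hf g hg hfg
    by_contra hne
    obtain ⟨i, hi⟩ := Function.ne_iff.1 hne
    refine hW (diffSet f g) (mem_types.2 ⟨⟨i, mem_diffSet.2 hi⟩, f, hf, g, hg, rfl⟩) ?_
    intro j hj
    by_contra hjW
    exact mem_diffSet.1 hj (congrFun hfg ⟨j, mem_compl.2 hjW⟩)
  have := card_le_card_of_injOn (t := univ) _ (fun _ _ => mem_univ _) hinj
  rwa [card_univ, Fintype.card_fun, Fintype.card_coe, card_compl] at this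

/-- Induction on the number of types. Either everything rich survives the deletion process, and
then the union-closed types miss a whole `k`-set of coordinates, or `F` is covered by families `G E`
without rich members, each of which loses the type `E` on passing to a positive proportion. -/
lemma card_le_of_card_types {k : ℕ} (hk : 0 < k) (hm : k + k * 2 ^ k ≤ Fintype.card ι) (a : ℕ)
    (F : Finset (ι → α)) (ha : #(types F) ≤ a) (hF : ∀ E ∈ types F, #E ≠ k) :
    #F ≤ (2 ^ Fintype.card ι * Fintype.card ι) ^ a *
      Fintype.card α ^ (Fintype.card ι - k) := by
  induction a generalizing F with
  | zero =>
    obtain ⟨W, -, hW⟩ := exists_subset_card_eq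
      (show k ≤ #(univ : Finset ι) by rw [card_univ]; omega)
    have h0 : types F = ∅ := card_eq_zero.1 (by omega)
    simpa [hW] using card_le_pow_of_forall_types_not_subset (F := F) (W := W) (by simp [h0])
  | succ a ih =>
    obtain ⟨H, hHF, hH, G, hG, hG'⟩ := exists_rich_or_poor (types F) F
    rcases H.eq_empty_or_nonempty with rfl | hne
    · rw [empty_union] at hG
      have hE : ∀ E ∈ types F, #(G E) ≤ Fintype.card ι *
          ((2 ^ Fintype.card ι * Fintype.card ι) ^ a *
            Fintype.card α ^ (Fintype.card ι - k)) := by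
        intro E hE
        obtain ⟨G', hG'G, hcard, hEG'⟩ := exists_subset_notMem_types (hG' E hE).2
        have hsub : types G' ⊆ types F := types_mono (hG'G.trans (hG' E hE).1)
        have hlt := card_lt_card
          (hsub.ssubset_of_ne fun h => hEG' (h ▸ hE))
        exact hcard.trans (Nat.mul_le_mul_left _
          (ih G' (by omega) fun D hD => hF D (hsub hD)))
      calc #F ≤ ∑ E ∈ types F, #(G E) := (card_le_card hG).trans card_biUnion_le
        _ ≤ #(types F) * _ := sum_le_card_nsmul _ _ _ hE
        _ ≤ 2 ^ Fintype.card ι * _ := by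
            refine Nat.mul_le_mul_right _ ((card_le_univ _).trans ?_)
            rw [Fintype.card_finset]
        _ = _ := by ring
    · obtain ⟨W, hWk, hW⟩ := exists_card_eq_forall_not_subset (types F)
        (fun E hE => (mem_types.1 hE).1)
        (fun D hD E hE => union_mem_types hne hHF hH hD hE) hF hm
      have := card_le_pow_of_forall_types_not_subset hW
      rw [hWk] at this
      have hι : 0 < Fintype.card ι := by omega
      exact this.trans (Nat.le_mul_of_pos_left _ (by positivity))

/-- Tuples over `N` letters, no two at Hamming distance `k`, form a family of density
`O(N⁻ᵏ)`, once the number of coordinates is large in terms of `k`. -/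
lemma card_le_of_forall_card_diffSet_ne {k : ℕ} (hk : 0 < k)
    (hm : k + k * 2 ^ k ≤ Fintype.card ι) (F : Finset (ι → α))
    (hF : ∀ f ∈ F, ∀ g ∈ F, #(diffSet f g) ≠ k) :
    #F ≤ (2 ^ Fintype.card ι * Fintype.card ι) ^ 2 ^ Fintype.card ι *
      Fintype.card α ^ (Fintype.card ι - k) := by
  refine card_le_of_card_types hk hm _ F ((card_le_univ _).trans ?_) ?_
  · rw [Fintype.card_finset]
  · intro E hE
    obtain ⟨-, f, hf, g, hg, rfl⟩ := mem_types.1 hE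
    exact hF f hf g hg

end Tuples

/-! ### Averaging over permutations -/

section Permutations

variable {V : Type*} [Fintype V] [DecidableEq V]

lemma exists_perm_map_eq {I J I' J' : Finset V} (hIJ : I ⊆ J) (hIJ' : I' ⊆ J') (hI : #I = #I')
    (hJ : #J = #J') :
    ∃ τ : Equiv.Perm V, I.map τ.toEmbedding = I' ∧ J.map τ.toEmbedding = J' := by
  set c : Finset V → Finset V → V → Bool × Bool :=
    fun I J x => (decide (x ∈ I), decide (x ∈ J)) with hc
  have hcard : ∀ b, Fintype.card {x // c I J x = b} = Fintype.card {x // c I' J' x = b} := by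
    have key : ∀ {I J : Finset V}, I ⊆ J → ∀ b, Fintype.card {x // c I J x = b} =
        match b with
        | (true, true) => #I
        | (true, false) => 0
        | (false, true) => #J - #I
        | (false, false) => Fintype.card V - #J := by
      intro I J h b
      rw [Fintype.card_subtype]
      rcases b with ⟨_ | _, _ | _⟩ <;> simp only [hc, Prod.mk.injEq, decide_eq_true_eq,
        decide_eq_false_iff_not]
      · rw [← card_compl]
        congr 1
        ext x
        simpa using fun h1 h2 => h1 (h h2)
      · rw [← card_sdiff_of_subset h]
        congr 1
        ext x
        simp [and_comm]
      · rw [card_eq_zero, filter_eq_empty_iff]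
        exact fun x _ hx => hx.2 (h hx.1)
      · congr 1
        ext x
        simpa using fun h1 => h h1
    intro b
    rw [key hIJ, key hIJ', hI, hJ]
  have e : ∀ b, {x // c I J x = b} ≃ {x // c I' J' x = b} :=
    fun b => Fintype.equivOfCardEq (hcard b)
  have hmap : ∀ x, c I' J' (Equiv.ofFiberEquiv e x) = c I J x := Equiv.ofFiberEquiv_map e
  simp only [hc, Prod.mk.injEq, decide_eq_decide] at hmap
  refine ⟨Equiv.ofFiberEquiv e, ?_, ?_⟩
  · ext y
    rw [mem_map_equiv, ← (hmap _).1, Equiv.apply_symm_apply]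
  · ext y
    rw [mem_map_equiv, ← (hmap _).2, Equiv.apply_symm_apply]

/-- The number of permutations mapping both `I` and `J` into the family `𝒜`. -/
def hits (𝒜 : Finset (Finset V)) (I J : Finset V) : ℕ :=
  #{σ : Equiv.Perm V | I.map σ.toEmbedding ∈ 𝒜 ∧ J.map σ.toEmbedding ∈ 𝒜}

lemma hits_eq_hits (𝒜 : Finset (Finset V)) {I J I' J' : Finset V} (hIJ : I ⊆ J)
    (hIJ' : I' ⊆ J') (hI : #I = #I') (hJ : #J = #J') : hits 𝒜 I J = hits 𝒜 I' J' := by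
  obtain ⟨τ, rfl, rfl⟩ := exists_perm_map_eq hIJ hIJ' hI hJ
  refine card_equiv (Equiv.mulRight τ⁻¹) fun σ => ?_
  have : τ.toEmbedding.trans (σ * τ⁻¹).toEmbedding = σ.toEmbedding := by
    ext x
    simp
  simp only [mem_filter, mem_univ, true_and, Equiv.coe_mulRight, map_map, this]

lemma hits_self_mul_choose (𝒜 : Finset (Finset V)) (I : Finset V) :
    hits 𝒜 I I * (Fintype.card V).choose #I = (Fintype.card V).factorial * #{A ∈ 𝒜 | #A = #I} := by
  have h1 : ∑ J ∈ powersetCard #I univ, hits 𝒜 J J =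
      hits 𝒜 I I * (Fintype.card V).choose #I := by
    rw [sum_const_nat (m := hits 𝒜 I I), card_powersetCard, card_univ, mul_comm]
    intro J hJ
    have hJ := (mem_powersetCard.1 hJ).2
    exact hits_eq_hits 𝒜 Subset.rfl Subset.rfl hJ hJ
  have h2 : ∀ σ : Equiv.Perm V, #{J ∈ powersetCard #I univ | J.map σ.toEmbedding ∈ 𝒜} =
      #{A ∈ 𝒜 | #A = #I} := by
    intro σ
    refine card_equiv (Equiv.finsetCongr σ) fun J => ?_
    simp [mem_powersetCard, and_comm]
  rw [← h1]
  simp only [hits, and_self, card_filter]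
  rw [sum_comm]
  simp only [← card_filter, h2]
  simp [Fintype.card_perm]

end Permutations

/-! ### Chains attached to a grid -/

/-- The chain of initial segments of `Fin n`. -/
def initSeg (n i : ℕ) : Finset (Fin n) := {x | x.val < i}

lemma mem_initSeg {n i : ℕ} {x : Fin n} : x ∈ initSeg n i ↔ x.val < i := by
  simp [initSeg]

lemma card_initSeg {n i : ℕ} (h : i ≤ n) : #(initSeg n i) = i := by
  rw [initSeg, Fin.card_filter_val_lt, min_eq_right h]

lemma initSeg_mono {n i j : ℕ} (h : i ≤ j) : initSeg n i ⊆ initSeg n j := fun _ hx =>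
  mem_initSeg.2 ((mem_initSeg.1 hx).trans_le h)

/-- Tuples in `Fin m → Fin N`, viewed as transversals of an `m × N` grid placed at the upper end
of `Fin n`: set differences become difference sets of tuples. -/
lemma exists_transversals {n m N : ℕ} (h : m * N ≤ n) :
    ∃ T : (Fin m → Fin N) → Finset (Fin n), (∀ f, #(T f) = m) ∧
      (∀ f, ∀ x ∈ T f, n - m * N ≤ x.val) ∧ ∀ f g, #(T f \ T g) = #(diffSet f g) := by
  set e : Fin m × Fin N → Fin n := fun p => (Fin.castLE h (finProdFinEquiv p)).rev with he
  have hinj : Function.Injective e :=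
    Fin.rev_injective.comp ((Fin.castLE_injective h).comp finProdFinEquiv.injective)
  have hinj' : ∀ f : Fin m → Fin N, Function.Injective fun i => e (i, f i) := fun f i j hij =>
    congrArg Prod.fst (hinj hij)
  refine ⟨fun f => univ.image fun i => e (i, f i), fun f => ?_, fun f x hx => ?_, fun f g => ?_⟩
  · rw [card_image_of_injective _ (hinj' f), card_univ, Fintype.card_fin]
  · obtain ⟨i, -, rfl⟩ := mem_image.1 hx
    have := (finProdFinEquiv (i, f i)).isLt
    simp only [he, Fin.val_rev, Fin.val_castLE]
    omega
  · rw [← card_image_of_injective (diffSet f g) (hinj' f)]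
    congr 1
    ext x
    simp only [mem_sdiff, mem_image, mem_univ, true_and, mem_diffSet]
    constructor
    · rintro ⟨⟨i, rfl⟩, h⟩
      exact ⟨i, fun hi => h ⟨i, by rw [hi]⟩, rfl⟩
    · rintro ⟨i, hi, rfl⟩
      refine ⟨⟨i, rfl⟩, fun ⟨j, hj⟩ => ?_⟩
      have := hinj hj
      simp only [Prod.mk.injEq] at this
      obtain ⟨rfl, h⟩ := this
      exact hi h.symm

section Main

variable {k m n N : ℕ}

/-- The constant in the density bound for tuples with `m` coordinates. -/
def tupleConst (m : ℕ) : ℕ := (2 ^ m * m) ^ 2 ^ m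

lemma card_initSeg_union {T : Finset (Fin n)} {i : ℕ} (hi : i + m * N ≤ n)
    (hT : ∀ x ∈ T, n - m * N ≤ x.val) : #(initSeg n i ∪ T) = i + #T := by
  rw [card_union_of_disjoint, card_initSeg (by omega)]
  rw [disjoint_left]
  intro x hx hxT
  have := mem_initSeg.1 hx
  have := hT x hxT
  omega

/-- The tuples `f` for which some member of the chain `i ↦ σ (initSeg n i ∪ T f)` lies in `𝒜` have no
two at Hamming distance `k`: the smaller of two such members differs from the larger only inside the
grid. -/
lemma card_le_of_transversals (hk : 0 < k) (hm : k + k * 2 ^ k ≤ m)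
    {𝒜 : Finset (Finset (Fin n))} (h𝒜 : ∀ A ∈ 𝒜, ∀ B ∈ 𝒜, #(A \ B) ≠ k)
    {T : (Fin m → Fin N) → Finset (Fin n)}
    (hTn : ∀ f, ∀ x ∈ T f, n - m * N ≤ x.val)
    (hT : ∀ f g, #(T f \ T g) = #(diffSet f g)) (L : Finset ℕ) (hL : ∀ i ∈ L, i + m * N ≤ n)
    (σ : Equiv.Perm (Fin n)) :
    #{f | ∃ i ∈ L, (initSeg n i ∪ T f).map σ.toEmbedding ∈ 𝒜} ≤ tupleConst m * N ^ (m - k) := by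
  have := card_le_of_forall_card_diffSet_ne (ι := Fin m) (α := Fin N) hk (by simpa using hm)
    {f | ∃ i ∈ L, (initSeg n i ∪ T f).map σ.toEmbedding ∈ 𝒜} ?_
  · simpa [tupleConst] using this
  have key : ∀ f g i j, i ≤ j → j ∈ L → (initSeg n i ∪ T f).map σ.toEmbedding ∈ 𝒜 →
      (initSeg n j ∪ T g).map σ.toEmbedding ∈ 𝒜 → #(diffSet f g) ≠ k := by
    intro f g i j hij hj hf hg
    have h := h𝒜 _ hf _ hg
    rw [← Finset.map_sdiff, card_map] at h
    rw [← hT]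
    convert h using 2
    ext x
    have h1 : x ∈ initSeg n i → x ∈ initSeg n j := fun h => initSeg_mono hij h
    have h2 : x ∈ T f → x ∉ initSeg n j := by
      intro hx hxj
      have := hTn f x hx
      have := mem_initSeg.1 hxj
      have := hL j hj
      omega
    simp only [mem_sdiff, mem_union]
    tauto
  simp only [mem_filter, mem_univ, true_and]
  rintro f ⟨i, hi, hf⟩ g ⟨j, hj, hg⟩
  rcases le_total i j with hij | hij
  · exact key f g i j hij hj hf hg
  · have : diffSet f g = diffSet g f := by
      ext
      simp [mem_diffSet, ne_comm]
    rw [this]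
    exact key g f j i hij hi hg hf

/-- Given that a random copy of `I` lies in `𝒜`, a random copy of `J ⊇ I` does so with
probability `O(N⁻ᵏ)`: the density bound for tuples, averaged over the part of `J` off `I`. -/
lemma hits_le (hk : 0 < k) (hm : k + k * 2 ^ k ≤ m) (hN : 0 < N)
    {𝒜 : Finset (Finset (Fin n))} (h𝒜 : ∀ A ∈ 𝒜, ∀ B ∈ 𝒜, #(A \ B) ≠ k)
    {I J : Finset (Fin n)} (hIJ : I ⊆ J) (hcard : #I + m ≤ #J) (hJ : #J + m * N ≤ n + m) :
    N ^ k * hits 𝒜 I J ≤ tupleConst m * hits 𝒜 I I := by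
  obtain ⟨T, hTm, hTn, hT⟩ := exists_transversals (n := n) (m := m) (N := N) (by omega)
  have hIn : #(initSeg n #I) = #I := card_initSeg (by omega)
  have h1 : ∀ f, hits 𝒜 I J = hits 𝒜 (initSeg n #I) (initSeg n (#J - m) ∪ T f) := by
    intro f
    refine hits_eq_hits 𝒜 hIJ ((initSeg_mono (by omega)).trans subset_union_left) hIn.symm ?_
    rw [card_initSeg_union (m := m) (N := N) (by omega) (hTn f), hTm]
    omega
  have h2 : N ^ m * hits 𝒜 I J ≤ hits 𝒜 I I * (tupleConst m * N ^ (m - k)) := by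
    calc N ^ m * hits 𝒜 I J
        = ∑ f : Fin m → Fin N, hits 𝒜 (initSeg n #I) (initSeg n (#J - m) ∪ T f) := by
          simp [← h1]
      _ = ∑ σ : Equiv.Perm (Fin n) with (initSeg n #I).map σ.toEmbedding ∈ 𝒜,
            #{f | (initSeg n (#J - m) ∪ T f).map σ.toEmbedding ∈ 𝒜} := by
          simp only [hits, ← filter_filter, card_filter]
          rw [sum_comm]
      _ ≤ #{σ : Equiv.Perm (Fin n) | (initSeg n #I).map σ.toEmbedding ∈ 𝒜} *
            (tupleConst m * N ^ (m - k)) := by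
          refine sum_le_card_nsmul _ _ _ fun σ _ => ?_
          have := card_le_of_transversals hk hm h𝒜 hTn hT {#J - m} (by simp; omega) σ
          simpa using this
      _ = _ := by
          rw [hits_eq_hits 𝒜 (Subset.refl I) (Subset.refl _) hIn.symm hIn.symm, hits]
          simp only [and_self]
  have hmk : N ^ m = N ^ (m - k) * N ^ k := by
    rw [← pow_add]
    congr 1
    have := Nat.zero_le (k * 2 ^ k)
    omega
  refine Nat.le_of_mul_le_mul_left (c := N ^ (m - k)) ?_ (by positivity)
  calc N ^ (m - k) * (N ^ k * hits 𝒜 I J) = N ^ m * hits 𝒜 I J := by rw [hmk]; ring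
    _ ≤ _ := h2
    _ = _ := by ring

/-- The Bonferroni-type inequality `|Z| - #{pairs in Z} ≤ 1`. -/
lemma card_le_one_add_pairs (Z : Finset ℕ) :
    #Z ≤ (if Z.Nonempty then 1 else 0) + ∑ i ∈ Z, #{j ∈ Z | i < j} := by
  rcases Z.eq_empty_or_nonempty with rfl | hZ
  · simp
  · have h : {j ∈ Z | Z.min' hZ < j} = Z.erase (Z.min' hZ) := by
      ext j
      simp only [mem_filter, mem_erase]
      constructor
      · exact fun h => ⟨h.2.ne', h.1⟩
      · exact fun h => ⟨h.2, lt_of_le_of_ne (min'_le Z j h.2) h.1.symm⟩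
    have h1 := single_le_sum (f := fun i => #{j ∈ Z | i < j}) (fun _ _ => Nat.zero_le _)
      (min'_mem Z hZ)
    simp only [h, card_erase_of_mem (min'_mem Z hZ)] at h1
    rw [if_pos hZ]
    omega

lemma card_filter_modEq_le {M l n : ℕ} (hM : 0 < M) (hl : l ≤ n + 1) (i : ℕ) :
    #{j ∈ range l | i < j ∧ i ≡ j [MOD M]} ≤ n / M := by
  have : #{j ∈ range l | i < j ∧ i ≡ j [MOD M]} ≤ #(Icc 1 (n / M)) := by
    refine card_le_card_of_injOn (fun j => (j - i) / M) ?_ ?_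
    · intro j hj
      simp only [coe_filter, mem_range, Set.mem_ofPred_eq] at hj
      obtain ⟨q, hq⟩ := (Nat.modEq_iff_dvd' hj.2.1.le).1 hj.2.2
      simp only [coe_Icc, Set.mem_Icc]
      refine ⟨(Nat.one_le_div_iff hM).2 (Nat.le_of_dvd (by omega) ⟨q, hq⟩),
        Nat.div_le_div_right (by omega)⟩
    · intro j hj j' hj' hjj
      simp only [coe_filter, mem_range, Set.mem_ofPred_eq] at hj hj'
      have h1 := Nat.div_mul_cancel ((Nat.modEq_iff_dvd' hj.2.1.le).1 hj.2.2)
      have h2 := Nat.div_mul_cancel ((Nat.modEq_iff_dvd' hj'.2.1.le).1 hj'.2.2)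
      simp only at hjj
      rw [hjj, h2] at h1
      omega
  simpa using this

/-- The bound for a family whose set sizes lie away from the ends and in one residue class modulo
a large constant `M`. On the random chains `σ (initSeg n i ∪ T f)`, the residue condition makes
the expected number of comparable pairs at most half the expected number of members of `𝒜`. -/
lemma pow_mul_card_le (hk : 0 < k) (hm : k + k * 2 ^ k ≤ m) (hN : 0 < N) {M : ℕ}
    (hmM : m ≤ M) (hM : 2 * tupleConst m * n ≤ M * N ^ k) (hmN : m * N ≤ n)
    {𝒜 : Finset (Finset (Fin n))}
    (h𝒜 : ∀ A ∈ 𝒜, ∀ B ∈ 𝒜, #(A \ B) ≠ k) (hmod : ∀ A ∈ 𝒜, ∀ B ∈ 𝒜, #A ≡ #B [MOD M])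
    (hlow : ∀ A ∈ 𝒜, m ≤ #A) (hupp : ∀ A ∈ 𝒜, #A + m * N ≤ n + m) :
    N ^ k * #𝒜 ≤ 2 * tupleConst m * n.choose (n / 2) := by
  have hkm : k ≤ m := (Nat.le_add_right _ _).trans hm
  have hM0 : 0 < M := by omega
  obtain ⟨T, hTm, hTn, hT⟩ := exists_transversals (n := n) (m := m) (N := N) hmN
  set L := range (n - m * N + 1) with hL
  have hLn : ∀ i ∈ L, i + m * N ≤ n := by
    intro i hi
    rw [hL, mem_range] at hi
    omega
  set Q : ℕ → (Fin m → Fin N) → Finset (Fin n) := fun i f => initSeg n i ∪ T f with hQ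
  have hQcard : ∀ i ∈ L, ∀ f, #(Q i f) = i + m := by
    intro i hi f
    rw [hQ]
    dsimp only
    rw [card_initSeg_union (hLn i hi) (hTn f), hTm]
  have hpair : ∀ f, ∀ i ∈ L,
      2 * ∑ j ∈ L with i < j, hits 𝒜 (Q i f) (Q j f) ≤ hits 𝒜 (Q i f) (Q i f) := by
    intro f i hi
    have h0 : ∑ j ∈ L with i < j, hits 𝒜 (Q i f) (Q j f) =
        ∑ j ∈ L with i < j ∧ i ≡ j [MOD M], hits 𝒜 (Q i f) (Q j f) := by
      rw [← filter_filter]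
      refine (sum_filter_of_ne fun j hj hne => ?_).symm
      obtain ⟨σ, hσ⟩ := card_pos.1 (Nat.pos_of_ne_zero hne)
      simp only [mem_filter, mem_univ, true_and] at hσ
      have := hmod _ hσ.1 _ hσ.2
      rw [card_map, card_map, hQcard i hi, hQcard j (mem_filter.1 hj).1] at this
      exact Nat.ModEq.add_right_cancel' m this
    have h1 : N ^ k * ∑ j ∈ L with i < j ∧ i ≡ j [MOD M], hits 𝒜 (Q i f) (Q j f) ≤
        n / M * (tupleConst m * hits 𝒜 (Q i f) (Q i f)) := by
      rw [mul_sum]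
      refine (sum_le_card_nsmul _ _ (tupleConst m * hits 𝒜 (Q i f) (Q i f)) ?_).trans
        (Nat.mul_le_mul_right _ (card_filter_modEq_le hM0 (by omega) i))
      intro j hj
      simp only [mem_filter] at hj
      have hle := Nat.le_of_dvd (by omega) ((Nat.modEq_iff_dvd' hj.2.1.le).1 hj.2.2)
      have := hLn j hj.1
      refine hits_le hk hm hN h𝒜 (union_subset_union_left (initSeg_mono hj.2.1.le)) ?_ ?_
      · rw [hQcard i hi, hQcard j hj.1]
        omega
      · rw [hQcard j hj.1]
        omega
    have h2 : 2 * (n / M) * tupleConst m ≤ N ^ k := by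
      refine Nat.le_of_mul_le_mul_left (c := M) ?_ hM0
      calc M * (2 * (n / M) * tupleConst m) = 2 * tupleConst m * (M * (n / M)) := by ring
        _ ≤ 2 * tupleConst m * n := Nat.mul_le_mul_left _ (Nat.mul_div_le n M)
        _ ≤ _ := hM
    rw [h0]
    refine Nat.le_of_mul_le_mul_left (c := N ^ k) ?_ (by positivity)
    calc _ = 2 * (N ^ k * ∑ j ∈ L with i < j ∧ i ≡ j [MOD M], hits 𝒜 (Q i f) (Q j f)) := by ring
      _ ≤ 2 * (n / M * (tupleConst m * hits 𝒜 (Q i f) (Q i f))) := Nat.mul_le_mul_left _ h1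
      _ = 2 * (n / M) * tupleConst m * hits 𝒜 (Q i f) (Q i f) := by ring
      _ ≤ _ := Nat.mul_le_mul_right _ h2
  have hbonf : ∑ f, ∑ i ∈ L, hits 𝒜 (Q i f) (Q i f) ≤
      n.factorial * (tupleConst m * N ^ (m - k)) +
        ∑ f, ∑ i ∈ L, ∑ j ∈ L with i < j, hits 𝒜 (Q i f) (Q j f) := by
    have hσ : ∀ σ : Equiv.Perm (Fin n),
        ∑ f, ∑ i ∈ L, (if (Q i f).map σ.toEmbedding ∈ 𝒜 ∧ (Q i f).map σ.toEmbedding ∈ 𝒜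
          then 1 else 0) ≤ tupleConst m * N ^ (m - k) + ∑ f, ∑ i ∈ L, ∑ j ∈ L with i < j,
            if (Q i f).map σ.toEmbedding ∈ 𝒜 ∧ (Q j f).map σ.toEmbedding ∈ 𝒜
              then 1 else 0 := by
      intro σ
      refine le_trans ?_ (Nat.add_le_add_right
        (card_le_of_transversals hk hm h𝒜 hTn hT L hLn σ) _)
      rw [card_filter, ← sum_add_distrib]
      refine sum_le_sum fun f _ => ?_
      have := card_le_one_add_pairs {i ∈ L | (Q i f).map σ.toEmbedding ∈ 𝒜}
      simp only [and_self]
      rw [← card_filter]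
      refine this.trans (Nat.add_le_add (le_of_eq ?_) (le_of_eq ?_))
      · simp [Finset.Nonempty, hQ]
      · rw [sum_filter]
        refine sum_congr rfl fun i _ => ?_
        split_ifs with h
        · rw [filter_filter, ← card_filter, filter_filter]
          simp [h, and_comm]
        · simp [h]
    have := sum_le_sum (s := (univ : Finset (Equiv.Perm (Fin n)))) fun σ _ => hσ σ
    rw [sum_add_distrib, sum_const, card_univ, Fintype.card_perm, Fintype.card_fin,
      smul_eq_mul] at this
    simp only [hits, card_filter]
    refine le_of_eq_of_le ?_ (this.trans_eq ?_)
    · rw [eq_comm, sum_comm]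
      exact sum_congr rfl fun f _ => sum_comm
    · congr 1
      rw [sum_comm]
      refine sum_congr rfl fun f _ => ?_
      rw [sum_comm]
      exact sum_congr rfl fun i _ => sum_comm
  have htotal : ∑ f, ∑ i ∈ L, hits 𝒜 (Q i f) (Q i f) ≤
      2 * (n.factorial * (tupleConst m * N ^ (m - k))) := by
    have : 2 * ∑ f, ∑ i ∈ L, ∑ j ∈ L with i < j, hits 𝒜 (Q i f) (Q j f) ≤
        ∑ f, ∑ i ∈ L, hits 𝒜 (Q i f) (Q i f) := by
      rw [mul_sum]
      refine sum_le_sum fun f _ => ?_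
      rw [mul_sum]
      exact sum_le_sum fun i hi => hpair f i hi
    omega
  have hcount : ∀ f, n.factorial * #𝒜 ≤
      n.choose (n / 2) * ∑ i ∈ L, hits 𝒜 (Q i f) (Q i f) := by
    intro f
    rw [mul_sum, card_eq_sum_card_fiberwise (f := fun A => #A - m) (s := 𝒜) (t := L), mul_sum]
    · refine sum_le_sum fun i hi => ?_
      have := hits_self_mul_choose 𝒜 (Q i f)
      rw [Fintype.card_fin, hQcard i hi f] at this
      calc _ = n.factorial * #{A ∈ 𝒜 | #A = i + m} := by
            congr 2
            refine filter_congr fun A hA => ?_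
            have := hlow A hA
            omega
        _ = _ := this.symm
        _ ≤ _ := by
            rw [mul_comm]
            exact Nat.mul_le_mul_right _ (Nat.choose_le_middle _ _)
    · intro A hA
      have := hupp A hA
      have := hlow A hA
      simp only [hL, coe_range, Set.mem_Iio]
      omega
  have hmk : N ^ m = N ^ (m - k) * N ^ k := by
    rw [← pow_add, Nat.sub_add_cancel hkm]
  have hsum := sum_le_sum (s := (univ : Finset (Fin m → Fin N))) fun f _ => hcount f
  rw [← mul_sum univ _ (n.choose (n / 2))] at hsum
  simp only [sum_const, card_univ, Fintype.card_fun, Fintype.card_fin, smul_eq_mul] at hsum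
  refine Nat.le_of_mul_le_mul_left (c := N ^ (m - k) * n.factorial) ?_ (by positivity)
  calc _ = N ^ m * (n.factorial * #𝒜) := by rw [hmk]; ring
    _ ≤ _ := hsum
    _ ≤ n.choose (n / 2) * (2 * (n.factorial * (tupleConst m * N ^ (m - k)))) :=
        Nat.mul_le_mul_left _ htotal
    _ = _ := by ring

end Main

/-! ### The construction for the lower bound -/

section LowerBound

open Polynomial

/-- The monic polynomial with root set `x(A)`. -/
noncomputable def rootPoly {V K : Type*} [Field K] (x : V → K) (A : Finset V) : K[X] :=
  ∏ a ∈ A, (X - C (x a))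

variable {V K : Type*} [Field K] {x : V → K}

lemma natDegree_rootPoly (A : Finset V) : (rootPoly x A).natDegree = #A := by
  simp [rootPoly]

lemma rootPoly_monic (A : Finset V) : (rootPoly x A).Monic :=
  monic_prod_of_monic _ _ fun _ _ => monic_X_sub_C _

/-- Equal-sized sets whose polynomials agree in the `k` coefficients below the leading one do not
differ in exactly `k` elements: after division by the common factor `rootPoly x (A ∩ B)`, the
difference of the two cofactors has no room for a nonzero coefficient. -/
lemma card_sdiff_ne_of_coeff_eq [DecidableEq V] (hx : Function.Injective x) {A B : Finset V}
    {k w : ℕ} (hk : 0 < k)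
    (hA : #A = w) (hB : #B = w)
    (h : ∀ i < k, (rootPoly x A).coeff (w - 1 - i) = (rootPoly x B).coeff (w - 1 - i)) :
    #(A \ B) ≠ k := by
  intro hAB
  have hBA : #(B \ A) = k := by
    have h1 := card_sdiff_add_card_inter A B
    have h2 := card_sdiff_add_card_inter B A
    rw [inter_comm] at h2
    omega
  have hint : #(A ∩ B) + k = w := by
    have h1 := card_sdiff_add_card_inter A B
    omega
  set D := rootPoly x (A \ B) - rootPoly x (B \ A) with hD
  have hfac : rootPoly x A - rootPoly x B = rootPoly x (A ∩ B) * D := by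
    rw [hD, mul_sub]
    congr 1
    · rw [mul_comm, rootPoly, rootPoly, rootPoly, ← prod_union (disjoint_sdiff_inter A B),
        sdiff_union_inter]
    · rw [mul_comm, inter_comm, rootPoly, rootPoly, rootPoly,
        ← prod_union (disjoint_sdiff_inter B A), sdiff_union_inter]
  have hD0 : D ≠ 0 := by
    intro h0
    obtain ⟨a, ha⟩ := card_pos.1 (hAB ▸ hk)
    have h1 : (rootPoly x (A \ B)).eval (x a) = 0 := by
      rw [rootPoly, eval_prod]
      exact prod_eq_zero ha (by simp)
    rw [sub_eq_zero.1 (hD.symm.trans h0), rootPoly, eval_prod, prod_eq_zero_iff] at h1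
    obtain ⟨b, hb, hab⟩ := h1
    have : a = b := hx (by simpa [sub_eq_zero] using hab)
    subst this
    exact (mem_sdiff.1 ha).2 (mem_sdiff.1 hb).1
  have hdeg : (rootPoly x A - rootPoly x B).natDegree = #(A ∩ B) + D.natDegree := by
    rw [hfac, (rootPoly_monic _).natDegree_mul' hD0, natDegree_rootPoly]
  have hne : rootPoly x A - rootPoly x B ≠ 0 := by
    rw [hfac]
    exact mul_ne_zero (rootPoly_monic _).ne_zero hD0
  have hle : (rootPoly x A - rootPoly x B).natDegree ≤ w := by
    refine (natDegree_sub_le _ _).trans ?_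
    simp [natDegree_rootPoly, hA, hB]
  have hcoeff := leadingCoeff_ne_zero.2 hne
  rw [leadingCoeff] at hcoeff
  set d := (rootPoly x A - rootPoly x B).natDegree
  rw [coeff_sub] at hcoeff
  apply hcoeff
  rw [sub_eq_zero]
  rcases hle.lt_or_eq with hlt | heq
  · have := h (w - 1 - d) (by omega)
    rwa [show w - 1 - (w - 1 - d) = d by omega] at this
  · have h1 := rootPoly_monic (x := x) A
    have h2 := rootPoly_monic (x := x) B
    rw [Monic, leadingCoeff, natDegree_rootPoly] at h1 h2
    rw [heq]
    rw [hA] at h1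
    rw [hB] at h2
    rw [h1, h2]

/-- The middle layer splits into `pᵏ` admissible classes, according to the `k` coefficients below the
leading one of the polynomials over `ZMod p`; the largest class is the required family. -/
lemma exists_family_choose_le {k n p : ℕ} (hk : 0 < k) (hp : p.Prime) (hnp : n ≤ p) :
    ∃ 𝒜 : Finset (Finset (Fin n)), (∀ A ∈ 𝒜, ∀ B ∈ 𝒜, #(A \ B) ≠ k) ∧
      n.choose (n / 2) ≤ p ^ k * #𝒜 := by
  have : Fact p.Prime := ⟨hp⟩
  set x : Fin n → ZMod p := fun i => (i.val : ZMod p) with hx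
  have hinj : Function.Injective x := by
    intro i j hij
    have := congrArg ZMod.val hij
    rw [ZMod.val_cast_of_lt (i.isLt.trans_le hnp), ZMod.val_cast_of_lt (j.isLt.trans_le hnp)]
      at this
    exact Fin.ext this
  set c : Finset (Fin n) → Fin k → ZMod p :=
    -- The truncated index for `k > n / 2` is harmless: then no two sets differ in `k` elements.
    fun A i => (rootPoly x A).coeff (n / 2 - 1 - i) with hc
  obtain ⟨y, -, hy⟩ := exists_max_image (univ : Finset (Fin k → ZMod p))
    (fun y => #{A ∈ powersetCard (n / 2) (univ : Finset (Fin n)) | c A = y}) univ_nonempty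
  refine ⟨{A ∈ powersetCard (n / 2) (univ : Finset (Fin n)) | c A = y}, ?_, ?_⟩
  · intro A hA B hB
    simp only [mem_filter, mem_powersetCard_univ] at hA hB
    refine card_sdiff_ne_of_coeff_eq hinj hk hA.1 hB.1 fun i hi => ?_
    exact congrFun (hA.2.trans hB.2.symm) ⟨i, hi⟩
  · calc n.choose (n / 2) = #(powersetCard (n / 2) (univ : Finset (Fin n))) := by simp
      _ = ∑ y, #{A ∈ powersetCard (n / 2) (univ : Finset (Fin n)) | c A = y} :=
          card_eq_sum_card_fiberwise (by simp [Set.MapsTo])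
      _ ≤ #(univ : Finset (Fin k → ZMod p)) * _ :=
          sum_le_card_nsmul _ _ _ fun z _ => hy z (mem_univ z)
      _ = _ := by simp [ZMod.card]

end LowerBound

/-! ### Sets of size far from the middle, and the upper bound -/

section Tails

lemma pow_mul_choose_le {n r : ℕ} (s : ℕ) (h : 3 * (r + s) ≤ n) :
    2 ^ s * n.choose r ≤ n.choose (r + s) := by
  induction s with
  | zero => simp
  | succ s ih =>
    have h1 := ih (by omega)
    have h2 := Nat.choose_succ_right_eq n (r + s)
    have h3 : 2 * n.choose (r + s) ≤ n.choose (r + s + 1) := by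
      refine Nat.le_of_mul_le_mul_left (c := r + s + 1) ?_ (by omega)
      calc (r + s + 1) * (2 * n.choose (r + s)) = n.choose (r + s) * (2 * (r + s + 1)) := by ring
        _ ≤ n.choose (r + s) * (n - (r + s)) := Nat.mul_le_mul_left _ (by omega)
        _ = _ := by rw [← h2, mul_comm]
    calc 2 ^ (s + 1) * n.choose r = 2 * (2 ^ s * n.choose r) := by ring
      _ ≤ 2 * n.choose (r + s) := Nat.mul_le_mul_left _ h1
      _ ≤ _ := h3

lemma pow_mul_choose_le_middle {n r : ℕ} (h : 4 * r < n ∨ 3 * n < 4 * r) (hr : r ≤ n) :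
    2 ^ (n / 12) * n.choose r ≤ n.choose (n / 2) := by
  rcases h with h | h
  · exact (pow_mul_choose_le (n / 12) (by omega)).trans (Nat.choose_le_middle _ _)
  · rw [← Nat.choose_symm hr]
    exact (pow_mul_choose_le (n / 12) (by omega)).trans (Nat.choose_le_middle _ _)

lemma pow_mul_card_tail_le {n : ℕ} (𝒜 : Finset (Finset (Fin n)))
    (h : ∀ A ∈ 𝒜, 4 * #A < n ∨ 3 * n < 4 * #A) :
    2 ^ (n / 12) * #𝒜 ≤ (n + 1) * n.choose (n / 2) := by
  rw [card_eq_sum_card_fiberwise (f := card) (s := 𝒜) (t := range (n + 1)), mul_sum]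
  · refine (sum_le_card_nsmul _ _ (n.choose (n / 2)) ?_).trans (by simp)
    intro r hr
    rcases Finset.eq_empty_or_nonempty {A ∈ 𝒜 | #A = r} with h0 | ⟨A, hA⟩
    · simp [h0]
    · have hA := mem_filter.1 hA
      refine le_trans (Nat.mul_le_mul_left _ ?_) (pow_mul_choose_le_middle (r := r)
        (hA.2 ▸ h A hA.1) (Nat.lt_succ_iff.1 (mem_range.1 hr)))
      calc _ ≤ #(powersetCard r (univ : Finset (Fin n))) := by
            refine card_le_card fun B hB => ?_
            simpa using (mem_filter.1 hB).2
        _ = _ := by simp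
  · intro A _
    simpa [Nat.lt_succ_iff] using card_finset_fin_le A

/-- Exponentials beat polynomials. -/
lemma exists_pow_le_mul_two_pow (K : ℕ) : ∃ D : ℕ, ∀ n : ℕ, (n + 1) ^ K ≤ D * 2 ^ (n / 12) := by
  have ht := tendsto_pow_const_div_const_pow_of_one_lt K (show (1 : ℝ) < 2 by norm_num)
  obtain ⟨D, hD⟩ := ht.bddAbove_range
  obtain ⟨D', hD'⟩ := exists_nat_ge D
  refine ⟨12 ^ K * (D' * 2), fun n => ?_⟩
  have h1 := (hD ⟨n / 12 + 1, rfl⟩).trans hD'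
  simp only at h1
  rw [div_le_iff₀ (by positivity)] at h1
  have h2 : (n / 12 + 1) ^ K ≤ D' * 2 ^ (n / 12 + 1) := by exact_mod_cast h1
  calc (n + 1) ^ K ≤ (12 * (n / 12 + 1)) ^ K := Nat.pow_le_pow_left (by omega) K
    _ = 12 ^ K * (n / 12 + 1) ^ K := mul_pow _ _ _
    _ ≤ 12 ^ K * (D' * 2 ^ (n / 12 + 1)) := Nat.mul_le_mul_left _ h2
    _ = _ := by ring

end Tails

/-- The upper bound, with natural numbers throughout. -/
lemma exists_pow_mul_card_le {k : ℕ} (hk : 0 < k) :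
    ∃ C : ℕ, ∀ n : ℕ, 1 ≤ n → ∀ 𝒜 : Finset (Finset (Fin n)),
      (∀ A ∈ 𝒜, ∀ B ∈ 𝒜, #(A \ B) ≠ k) → n ^ k * #𝒜 ≤ C * n.choose (n / 2) := by
  set m := k + k * 2 ^ k with hm
  have hm0 : 0 < m := by omega
  obtain ⟨D, hD⟩ := exists_pow_le_mul_two_pow (k + 1)
  set M := 32 * m * tupleConst m + m with hM
  refine ⟨(8 * m) ^ k * 2 ^ (8 * m) +
    (M * ((16 * m) ^ k * (2 * tupleConst m)) + D), fun n hn 𝒜 h𝒜 => ?_⟩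
  have hchoose : 0 < n.choose (n / 2) := Nat.choose_pos (Nat.div_le_self _ _)
  rcases lt_or_ge n (8 * m) with hsmall | hlarge
  · -- Boundedly many small `n` are absorbed by the constant.
    have h1 : #𝒜 ≤ 2 ^ n := (card_le_univ _).trans (by simp)
    calc n ^ k * #𝒜 ≤ (8 * m) ^ k * 2 ^ (8 * m) := Nat.mul_le_mul
          (Nat.pow_le_pow_left hsmall.le _)
          (h1.trans (Nat.pow_le_pow_right (by norm_num) hsmall.le))
      _ ≤ (8 * m) ^ k * 2 ^ (8 * m) * n.choose (n / 2) := Nat.le_mul_of_pos_right _ hchoose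
      _ ≤ _ := Nat.mul_le_mul_right _ (Nat.le_add_right _ _)
  · set N := n / (8 * m) with hN
    have hN0 : 0 < N := Nat.div_pos hlarge (by omega)
    have hNn : 8 * (m * N) ≤ n := by
      rw [← mul_assoc]
      exact Nat.mul_div_le n (8 * m)
    have hnN : n ≤ 16 * m * N := by
      have h1 := Nat.lt_mul_div_succ n (show 0 < 8 * m by omega)
      rw [← hN] at h1
      nlinarith
    set mid := 𝒜.filter fun A => ¬ (4 * #A < n ∨ 3 * n < 4 * #A) with hmid
    have htail : n ^ k * #{A ∈ 𝒜 | 4 * #A < n ∨ 3 * n < 4 * #A} ≤ D * n.choose (n / 2) := by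
      have h1 := pow_mul_card_tail_le {A ∈ 𝒜 | 4 * #A < n ∨ 3 * n < 4 * #A}
        fun A hA => (mem_filter.1 hA).2
      have h2 := hD n
      refine Nat.le_of_mul_le_mul_left (c := n + 1) ?_ (by omega)
      set t := #{A ∈ 𝒜 | 4 * #A < n ∨ 3 * n < 4 * #A}
      calc (n + 1) * (n ^ k * t) ≤ (n + 1) * ((n + 1) ^ k * t) := by gcongr; omega
        _ = (n + 1) ^ (k + 1) * t := by ring
        _ ≤ D * 2 ^ (n / 12) * t := Nat.mul_le_mul_right _ h2
        _ = D * (2 ^ (n / 12) * t) := by ring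
        _ ≤ D * ((n + 1) * n.choose (n / 2)) := Nat.mul_le_mul_left _ h1
        _ = _ := by ring
    have hclass : ∀ r, N ^ k * #{A ∈ mid | #A % M = r} ≤
        2 * tupleConst m * n.choose (n / 2) := by
      intro r
      refine pow_mul_card_le hk hm.ge hN0 (M := M) (by omega) ?_ (by omega) ?_ ?_ ?_ ?_
      · calc 2 * tupleConst m * n ≤ 2 * tupleConst m * (16 * m * N) := Nat.mul_le_mul_left _ hnN
          _ = 32 * m * tupleConst m * N := by ring
          _ ≤ M * N ^ k := Nat.mul_le_mul (by omega) (Nat.le_self_pow hk.ne' N)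
      · intro A hA B hB
        exact h𝒜 A (mem_filter.1 (mem_filter.1 hA).1).1 B (mem_filter.1 (mem_filter.1 hB).1).1
      · intro A hA B hB
        exact (mem_filter.1 hA).2.trans (mem_filter.1 hB).2.symm
      · intro A hA
        have := (mem_filter.1 (mem_filter.1 hA).1).2
        omega
      · intro A hA
        have := (mem_filter.1 (mem_filter.1 hA).1).2
        omega
    have hmidle : N ^ k * #mid ≤ M * (2 * tupleConst m * n.choose (n / 2)) := by
      rw [card_eq_sum_card_fiberwise (f := fun A => #A % M) (s := mid) (t := range M), mul_sum]
      · refine (sum_le_card_nsmul _ _ _ fun r _ => hclass r).trans (by simp)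
      · intro A _
        simpa using Nat.mod_lt _ (show 0 < M by omega)
    calc n ^ k * #𝒜
        = n ^ k * #{A ∈ 𝒜 | 4 * #A < n ∨ 3 * n < 4 * #A} + n ^ k * #mid := by
          rw [← mul_add, hmid, card_filter_add_card_filter_not]
      _ ≤ D * n.choose (n / 2) + (16 * m * N) ^ k * #mid := Nat.add_le_add htail
          (Nat.mul_le_mul_right _ (Nat.pow_le_pow_left hnN k))
      _ = D * n.choose (n / 2) + (16 * m) ^ k * (N ^ k * #mid) := by
          rw [mul_pow, mul_assoc]
      _ ≤ D * n.choose (n / 2) +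
          (16 * m) ^ k * (M * (2 * tupleConst m * n.choose (n / 2))) :=
          Nat.add_le_add_left (Nat.mul_le_mul_left _ hmidle) _
      _ = (M * ((16 * m) ^ k * (2 * tupleConst m)) + D) * n.choose (n / 2) := by ring
      _ ≤ _ := Nat.mul_le_mul_right _ (Nat.le_add_left _ _)

end SetDifference

theorem theorem3 (k : ℕ) :
    (∃ C : ℝ, 0 < C ∧ ∀ n : ℕ, 1 ≤ n → ∀ 𝒜 : Finset (Finset (Fin n)),
      (∀ A ∈ 𝒜, ∀ B ∈ 𝒜, (A \ B).card ≠ k) →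
        (𝒜.card : ℝ) ≤ C / (n : ℝ) ^ k * (n.choose (n / 2) : ℝ)) ∧
    (1 ≤ k →
      (∃ c : ℝ, 0 < c ∧ ∀ n : ℕ, 1 ≤ n → ∃ 𝒜 : Finset (Finset (Fin n)),
        (∀ A ∈ 𝒜, ∀ B ∈ 𝒜, (A \ B).card ≠ k) ∧
          c / (n : ℝ) ^ k * (n.choose (n / 2) : ℝ) ≤ (𝒜.card : ℝ)) ∧
      (∀ n : ℕ, n.Prime → ∃ 𝒜 : Finset (Finset (Fin n)),
        (∀ A ∈ 𝒜, ∀ B ∈ 𝒜, (A \ B).card ≠ k) ∧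
          1 / (n : ℝ) ^ k * (n.choose (n / 2) : ℝ) ≤ (𝒜.card : ℝ))) := by
  refine ⟨?_, fun hk => ⟨⟨1 / 2 ^ k, by positivity, fun n hn => ?_⟩, fun n hn => ?_⟩⟩
  · rcases Nat.eq_zero_or_pos k with rfl | hk
    · -- `A \ A` has size `0`, so only the empty family qualifies.
      refine ⟨1, one_pos, fun n _ 𝒜 h𝒜 => ?_⟩
      have : 𝒜 = ∅ := Finset.eq_empty_of_forall_notMem fun A hA => h𝒜 A hA A hA (by simp)
      rw [this, Finset.card_empty, Nat.cast_zero]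
      positivity
    · obtain ⟨C, hC⟩ := SetDifference.exists_pow_mul_card_le hk
      refine ⟨C + 1, by positivity, fun n hn 𝒜 h𝒜 => ?_⟩
      have hn' : (0 : ℝ) < n := by exact_mod_cast hn
      have h : (n : ℝ) ^ k * 𝒜.card ≤ C * n.choose (n / 2) := by exact_mod_cast hC n hn 𝒜 h𝒜
      rw [div_mul_eq_mul_div, le_div_iff₀ (by positivity)]
      have : (0 : ℝ) ≤ n.choose (n / 2) := by positivity
      linarith
  · -- A prime between `n` and `2 * n` costs a factor `2 ^ k`.
    obtain ⟨p, hp, hnp, hpn⟩ := Nat.exists_prime_lt_and_le_two_mul n (by omega)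
    obtain ⟨𝒜, h𝒜, hcard⟩ := SetDifference.exists_family_choose_le hk hp hnp.le
    refine ⟨𝒜, h𝒜, ?_⟩
    have hn' : (0 : ℝ) < n := by exact_mod_cast hn
    have h1 : (n.choose (n / 2) : ℝ) ≤ (2 * n) ^ k * 𝒜.card := by
      exact_mod_cast hcard.trans (Nat.mul_le_mul_right _ (Nat.pow_le_pow_left hpn k))
    rw [div_div, ← mul_pow, div_mul_eq_mul_div, one_mul, div_le_iff₀ (by positivity), mul_comm]
    exact h1
  · obtain ⟨𝒜, h𝒜, hcard⟩ := SetDifference.exists_family_choose_le hk hn le_rfl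
    refine ⟨𝒜, h𝒜, ?_⟩
    have hn' : (0 : ℝ) < n := by exact_mod_cast hn.pos
    have h1 : (n.choose (n / 2) : ℝ) ≤ (n : ℝ) ^ k * 𝒜.card := by exact_mod_cast hcard
    rw [div_mul_eq_mul_div, one_mul, div_le_iff₀ (by positivity), mul_comm]
    exact h1
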